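/- Let $\mathcal G=(\mathcal V,\mathcal E)$ be a finite directed acyclic network and $\mathcal S$ a finite set of sessions; session $s$ is available at the nodes in $a(s)\subseteq\mathcal V$ and demanded at the nodes in $b(s)\subseteq\mathcal V$, with $a(s)\cap b(s)=\emptyset$. The sources are i.i.d. copies of a random vector $Y_{\mathcal S}=(Y_s,\ s\in\mathcal S)$ with finite alphabets and an arbitrary joint distribution $P$. A capacity tuple $\mathbf C=(C_e:e\in\mathcal E)$ is achievable if there is a sequence of deterministic block codes of block length $n=1,2,\dots$, in which edge $e$ carries one of $M_e^{(n)}$ messages, a function of the source blocks available at the tail of $e$ and of the messages on the edges entering that tail, such that $\limsup_n \frac1n\log_2 M^{(n)}_e\le C_e$ for every $e$ and, for every $s$ and $u\in b(s)$, the probability that $u$ wrongly decodes the block of source $s$ (from the source blocks available at $u$ and the messages entering $u$) tends to $0$. Let $\mathcal R$ be the set of achievable tuples. For every $\mathcal W\subseteq\mathcal S$ and every partition $\langle\alpha\rangle=\{\alpha,\alpha^c\}$ of the support of $Y_{\mathcal W}=(Y_s, s\in\mathcal W)$ into two nonempty parts, let the binary partition variable $A^{\mathcal W}_{\langle\alpha\rangle}$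 be the part that contains $Y_{\mathcal W}$. Let $\Lambda$ be the set of all these pairs $(\mathcal W,\langle\alpha\rangle)$, and for $\mathcal Z\subseteq\Lambda$ write $A_{\mathcal Z}$ for the family of the variables indexed by $\mathcal Z$. For a set $\Delta$ of real functions $h$ on the subsets of the finite collection of symbols $X_s$ ($s\in\mathcal S$), $B_\lambda$ ($\lambda\in\Lambda$), $U_e$ ($e\in\mathcal E$), let $\mathcal R''(\Delta)$ be the set of all tuples $\mathbf C\in\mathbb R^{\mathcal E}$ for which some $h\in\Delta$ satisfies \begin{align*} h(X_{\mathcal W},B_{\mathcal Z})-H(Y_{\mathcal W},A_{\mathcal Z})&=0 &&\text{for all } \mathcal W\subseteq\mathcal S,\ \mathcal Z\subseteq\Lambda,\\ h(U_e\mid X_s: a(s)\to e,\ U_f: f\to e)&=0 &&\text{for all } e\in\mathcal E,\\ h(X_s: u\in b(s)\mid X_{s'}:u\in a(s'),\ U_e: e\to u)&=0 &&\text{for all } u\in\mathcal V,\\ C_e-h(U_e)&\ge 0 &&\text{for all } e\in\mathcal E, \end{align*} where $h(\beta\mid\gamma)=h(\beta\cup\gamma)-h(\gamma)$, entropies are in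 bits, $a(s)\to e$ means that the tail of $e$ lies in $a(s)$, $f\to e$ that $f$ enters the tail of $e$, and $e\to u$ that $e$ enters $u$. Let $\Gamma^*$ be the set of entropic functions, $\overline{\Gamma^*}$ its closure (the almost entropic functions) and $\Gamma$ the set of polymatroids. Then $\mathcal R\subseteq\mathcal R''(\overline{\Gamma^*})$ and $\mathcal R\subseteq\mathcal R''(\Gamma)$. Moreover $\mathcal R''(\Gamma)$ is a polyhedron with the following finite description: there are finitely many linear inequalities $$\sum_{\mathcal W\subseteq\mathcal S,\ \mathcal Z\subseteq\Lambda}k_{i,\mathcal W,\mathcal Z}\,H(Y_{\mathcal W},A_{\mathcal Z})\le\sum_{e\in\mathcal E}m_{i,e}\,C_e ,\qquad i=1,\dots,r,$$ with integer coefficients that depend only on the network (with its sessions) and on the support of $Y_{\mathcal S}$, not on its probabilities, whose solution set is exactly $\mathcal R''(\Gamma)$. -/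

import Mathlib

open Filter Topology

/-- A directed acyclic network (parallel edges allowed) with multicast sessions: session `s` is
available at the nodes in `src s` and demanded at the nodes in `dst s`. -/
structure Network (V E S : Type*) where
  tail : E → V
  head : E → V
  acyclic : ∀ v, ¬ Relation.TransGen (fun u w => ∃ e, tail e = u ∧ head e = w) v v
  src : S → Set V
  dst : S → Set V
  src_disjoint_dst : ∀ s, Disjoint (src s) (dst s)

namespace Network

variable {V E S : Type*} (N : Network V E S)

/-- The sources available at the node `v`. -/
def sourcesAt (v : V) : Set S := {s | v ∈ N.src s}

/-- The edges entering the node `v`. -/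
def edgesInto (v : V) : Set E := {e | N.head e = v}

/-- A deterministic block code of block length `n`: edge `e` carries one of `size e` messages,
computed from the source blocks available at the tail of `e` and the messages on the edges entering
that tail; a sink decodes from the source blocks available at it and the messages entering it.
`edge y e` is the message on `e` when the source blocks are `y`. -/
structure BlockCode (A : S → Type*) (n : ℕ) where
  size : E → ℕ
  enc : ∀ e, (∀ s : N.sourcesAt (N.tail e), Fin n → A s) →
    (∀ f : N.edgesInto (N.tail e), Fin (size f)) → Fin (size e)
  dec : ∀ s, ∀ u ∈ N.dst s, (∀ s' : N.sourcesAt u, Fin n → A s') →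
    (∀ f : N.edgesInto u, Fin (size f)) → Fin n → A s
  edge : (∀ s, Fin n → A s) → ∀ e, Fin (size e)
  edge_eq : ∀ y e, edge y e = enc e (fun s => y s) (fun f => edge y f)

open Classical in
/-- The probability that the sink `u` decodes session `s` wrongly, when the `n` time instances of
the sources are i.i.d. with joint law `P`. -/
noncomputable def BlockCode.errorProb {N : Network V E S} [Fintype S] {A : S → Type*}
    [∀ s, Fintype (A s)] {n : ℕ} (c : N.BlockCode A n) (P : PMF (∀ s, A s))
    (s : S) (u : V) (hu : u ∈ N.dst s) : ℝ :=
  ∑ y : ∀ s, Fin n → A s,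
    if c.dec s u hu (fun s' => y s') (fun f => c.edge y f) ≠ y s
    then ∏ t, (P (fun s' => y s' t)).toReal else 0

/-- The achievable capacity tuples: some sequence of block codes has vanishing decoding error at
every sink and asymptotically uses at most `C e` bits per time instance on every edge `e`. -/
def achievable [Fintype S] {A : S → Type*} [∀ s, Fintype (A s)] (P : PMF (∀ s, A s)) :
    Set (E → ℝ) :=
  {C | ∃ c : ∀ n, N.BlockCode A n,
    (∀ e, ∀ ε > 0, ∀ᶠ n : ℕ in atTop, Real.logb 2 ((c n).size e) ≤ n * (C e + ε)) ∧
    ∀ s u, ∀ hu : u ∈ N.dst s, Tendsto (fun n => (c n).errorProb P s u hu) atTop (𝓝 0)}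

end Network

open Classical in
/-- Shannon entropy, in bits, of a random variable on a finite probability space. -/
noncomputable def shannonEntropy {Ω β : Type*} [Fintype Ω] (p : PMF Ω) (X : Ω → β) : ℝ :=
  ∑ x ∈ Finset.univ.image X, Real.negMulLog (p.map X x).toReal / Real.log 2

/-- The entropic functions `Γ*`: `h α` is the joint entropy of the variables indexed by `α`, for
some jointly distributed random variables with finite alphabets. -/
def entropicFunctions (G : Type*) : Set (Set G → ℝ) :=
  {h | ∃ (m : ℕ) (p : PMF (Fin m)) (Z : G → Fin m → ℕ),
    ∀ α : Set G, h α = shannonEntropy p (fun ω (i : α) => Z i ω)}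

/-- The almost entropic functions, the closure of `Γ*`. -/
def almostEntropicFunctions (G : Type*) : Set (Set G → ℝ) := closure (entropicFunctions G)

/-- The polymatroids `Γ`. -/
def polymatroids (G : Type*) : Set (Set G → ℝ) :=
  {h | h ∅ = 0 ∧ (∀ α β, α ⊆ β → h α ≤ h β) ∧
    ∀ α β, h (α ∪ β) + h (α ∩ β) ≤ h α + h β}

section Partition

variable {S : Type*} [DecidableEq S] {A : S → Type*} [∀ s, DecidableEq (A s)]

/-- The support of the subvector `Y_W`, where `T` is the support of the whole vector `Y`. -/
def subvectorSupport (T : Finset (∀ s, A s)) (W : Finset S) : Finset (∀ s : W, A s) :=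
  T.image W.restrict

/-- The index set of all binary partition variables `A^W_⟨α⟩`: a subset `W` of the sources with a
partition `⟨α⟩ = {α, αᶜ}` of the support of `Y_W` into two nonempty parts. -/
def PartitionLabel (T : Finset (∀ s, A s)) : Type _ :=
  Σ W : Finset S, {π : Finpartition (subvectorSupport T W) // π.parts.card = 2}

/-- The binary partition variable `A^W_⟨α⟩`: the part that contains `Y_W`. -/
def PartitionLabel.var {T : Finset (∀ s, A s)} (l : PartitionLabel T) (y : ∀ s, A s) :
    Finset (∀ s : l.1, A s) :=
  l.2.1.part (l.1.restrict y)

noncomputable instance [Fintype S] (T : Finset (∀ s, A s)) : Fintype (PartitionLabel T) := by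
  classical
  unfold PartitionLabel
  infer_instance

/-- The joint entropy `H(Y_W, A_Z)` of the sources in `W` and the partition variables in `Z`. -/
noncomputable def sourceEntropy [Fintype S] [∀ s, Fintype (A s)] {T : Finset (∀ s, A s)}
    (P : PMF (∀ s, A s)) (W : Finset S) (Z : Finset (PartitionLabel T)) : ℝ :=
  shannonEntropy P (fun y => (W.restrict y, fun l : Z => l.1.var y))

end Partition

/-- The variables on which `h` is defined: one `X s` for each source, one `B l` for each partition
variable, one `U e` for each edge. -/
inductive NetVar (S L E : Type*)
  | X (s : S)
  | B (l : L)
  | U (e : E)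

open NetVar in
/-- The capacity tuples for which some `h ∈ Δ` satisfies the source, encoding, decoding and
edge-capacity constraints. -/
def outerRegion {V E S : Type*} [Fintype S] [DecidableEq S] {A : S → Type*} [∀ s, Fintype (A s)]
    [∀ s, DecidableEq (A s)] (N : Network V E S) (T : Finset (∀ s, A s)) (P : PMF (∀ s, A s))
    (Δ : Set (Set (NetVar S (PartitionLabel T) E) → ℝ)) : Set (E → ℝ) :=
  {C | ∃ h ∈ Δ,
    (∀ (W : Finset S) (Z : Finset (PartitionLabel T)),
      h (X '' (W : Set S) ∪ B '' (Z : Set (PartitionLabel T))) - sourceEntropy P W Z = 0) ∧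
    (∀ e, h ({U e} ∪ (X '' N.sourcesAt (N.tail e) ∪ U '' N.edgesInto (N.tail e))) -
      h (X '' N.sourcesAt (N.tail e) ∪ U '' N.edgesInto (N.tail e)) = 0) ∧
    (∀ u, h (X '' {s | u ∈ N.dst s} ∪ (X '' N.sourcesAt u ∪ U '' N.edgesInto u)) -
      h (X '' N.sourcesAt u ∪ U '' N.edgesInto u) = 0) ∧
    ∀ e, 0 ≤ C e - h {U e}}

/-!
Achievable tuples. A block code of length `n` turns the `n` source vectors, the partition variables
and the edge messages into one family of random variables. Its joint entropies, divided by `n`,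
satisfy the source constraints exactly (`blockEntropy_source`, since the source vectors are
independent) and the encoding constraints exactly (`blockEntropy_encode`), the capacity constraints
up to the excess rate (`blockEntropy_edge_le`) and the decoding constraints up to Fano's error term
(`blockEntropy_decode`). They are bounded, so along a subsequence of the codes they converge, and
the limit satisfies all constraints. The limit is almost entropic because scaling an entropic
function down stays in the closure of the entropic functions
(`smul_jointEntropy_mem_almostEntropicFunctions`): many copies are taken, and all of them are
switched on together with small probability, at a cost in entropy that vanishes in the limit.
Almost entropic functions are polymatroids, because joint entropy is monotone and submodular and
polymatroids form a closed set.

The polyhedron. Membership in the polymatroid region asks for some `h` satisfying a finite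
homogeneous system of linear inequalities in the values of `h`, the capacities and the source
entropies. Its coefficients are integers and involve the network and the support only.
Fourier–Motzkin elimination (`IsIntCone.exists_option`) removes the values of `h` one by one,
keeping the coefficients integral.

The cardinality bound, submodularity and Fano's inequality all come from Gibbs' inequality
(`natEntropy_le_of_subprobability`).
-/

/-! ### Entropy of a weighted finite space -/

section Entropy

variable {Ω β γ δ : Type*} [Fintype Ω]

open Classical in
/-- The probability of the value `x` of the random variable `X` under the weights `p`. -/
noncomputable def valueMass (p : Ω → ℝ) (X : Ω → β) (x : β) : ℝ :=
  ∑ ω, if X ω = x then p ω else 0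

/-- The entropy of `X`, in nats, as the expectation of `-log P(X)`. Summing over the sample space
rather than over values makes it visibly depend on the fibres of `X` only. -/
noncomputable def natEntropy (p : Ω → ℝ) (X : Ω → β) : ℝ :=
  -∑ ω, p ω * Real.log (valueMass p X (X ω))

lemma valueMass_nonneg {p : Ω → ℝ} (hp : ∀ ω, 0 ≤ p ω) (X : Ω → β) (x : β) :
    0 ≤ valueMass p X x :=
  Finset.sum_nonneg fun ω _ => by split_ifs <;> simp [hp]

lemma le_valueMass {p : Ω → ℝ} (hp : ∀ ω, 0 ≤ p ω) (X : Ω → β) (ω : Ω) :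
    p ω ≤ valueMass p X (X ω) := by
  classical
  have := Finset.single_le_sum (f := fun ω' => if X ω' = X ω then p ω' else 0)
    (fun ω' _ => by split_ifs <;> simp [hp]) (Finset.mem_univ ω)
  simpa [valueMass] using this

lemma valueMass_le_one {p : Ω → ℝ} (hp : p ∈ stdSimplex ℝ Ω) (X : Ω → β) (x : β) :
    valueMass p X x ≤ 1 := by
  rw [← hp.2]
  exact Finset.sum_le_sum fun ω _ => by split_ifs <;> simp [hp.1]

lemma valueMass_mono {p : Ω → ℝ} (hp : ∀ ω, 0 ≤ p ω) {X : Ω → β} {Y : Ω → γ} (ω : Ω)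
    (h : ∀ ω', Y ω' = Y ω → X ω' = X ω) :
    valueMass p Y (Y ω) ≤ valueMass p X (X ω) := by
  refine Finset.sum_le_sum fun ω' _ => ?_
  by_cases h1 : Y ω' = Y ω
  · simp [h1, h ω' h1]
  · rw [if_neg h1]; split_ifs <;> simp [hp]

lemma natEntropy_nonneg {p : Ω → ℝ} (hp : p ∈ stdSimplex ℝ Ω) (X : Ω → β) :
    0 ≤ natEntropy p X := by
  rw [natEntropy, neg_nonneg]
  exact Finset.sum_nonpos fun ω _ => mul_nonpos_of_nonneg_of_nonpos (hp.1 ω)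
    (Real.log_nonpos (valueMass_nonneg hp.1 X _) (valueMass_le_one hp X _))

lemma natEntropy_congr (p : Ω → ℝ) {X : Ω → β} {Y : Ω → γ}
    (h : ∀ ω ω', X ω = X ω' ↔ Y ω = Y ω') : natEntropy p X = natEntropy p Y := by
  have hm : ∀ ω, valueMass p X (X ω) = valueMass p Y (Y ω) := fun ω =>
    Finset.sum_congr rfl fun ω' _ => by classical exact if_congr (h ω' ω) rfl rfl
  simp only [natEntropy, hm]

lemma natEntropy_mono {p : Ω → ℝ} (hp : ∀ ω, 0 ≤ p ω) {X : Ω → β} {Y : Ω → γ}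
    (h : ∀ ω ω', Y ω = Y ω' → X ω = X ω') : natEntropy p X ≤ natEntropy p Y := by
  refine neg_le_neg (Finset.sum_le_sum fun ω _ => ?_)
  rcases (hp ω).eq_or_lt with h0 | h0
  · simp [← h0]
  · exact mul_le_mul_of_nonneg_left (Real.log_le_log (h0.trans_le (le_valueMass hp Y ω))
      (valueMass_mono hp ω fun ω' => h ω' ω)) h0.le

lemma natEntropy_of_subsingleton {p : Ω → ℝ} (hp : p ∈ stdSimplex ℝ Ω) [Subsingleton β]
    (X : Ω → β) : natEntropy p X = 0 := by
  have h : ∀ x, valueMass p X x = 1 := fun x => by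
    simp [valueMass, Subsingleton.elim _ x, hp.2]
  simp [natEntropy, h]

lemma sum_mul_comp_eq [DecidableEq β] (p : Ω → ℝ) (X : Ω → β) (f : β → ℝ) :
    ∑ ω, p ω * f (X ω) = ∑ x ∈ Finset.univ.image X, valueMass p X x * f x := by
  rw [← Finset.sum_fiberwise_of_maps_to (g := X) (t := Finset.univ.image X) (by simp)]
  refine Finset.sum_congr rfl fun x _ => ?_
  rw [valueMass, Finset.sum_mul, Finset.sum_filter]
  refine Finset.sum_congr rfl fun ω _ => ?_
  split_ifs with h <;> simp [h]

lemma sum_valueMass [DecidableEq β] {p : Ω → ℝ} (hp : p ∈ stdSimplex ℝ Ω) (X : Ω → β) :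
    ∑ x ∈ Finset.univ.image X, valueMass p X x = 1 := by
  simpa [hp.2] using (sum_mul_comp_eq p X fun _ => 1).symm

lemma sum_valueMass_prod [DecidableEq β] (p : Ω → ℝ) (X : Ω → β) (Y : Ω → γ) (y : γ) :
    ∑ x ∈ Finset.univ.image X, valueMass p (fun ω => (X ω, Y ω)) (x, y) = valueMass p Y y := by
  simp only [valueMass]
  rw [Finset.sum_comm]
  refine Finset.sum_congr rfl fun ω _ => ?_
  by_cases h : Y ω = y <;> simp [h]

/-- Gibbs' inequality: coding `X` with any subprobability `r` in place of its own law costs at least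
the entropy. The cardinality bound, submodularity and Fano's inequality are choices of `r`. -/
lemma natEntropy_le_of_subprobability [DecidableEq β] {p : Ω → ℝ}
    (hp : p ∈ stdSimplex ℝ Ω) (X : Ω → β) (r : β → ℝ) (hr : ∀ x, 0 ≤ r x)
    (hpos : ∀ ω, 0 < p ω → 0 < r (X ω)) (hsum : ∑ x ∈ Finset.univ.image X, r x ≤ 1) :
    natEntropy p X ≤ -∑ ω, p ω * Real.log (r (X ω)) := by
  have key : ∑ ω, p ω * Real.log (r (X ω)) - ∑ ω, p ω * Real.log (valueMass p X (X ω)) ≤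
      ∑ ω, p ω * (r (X ω) / valueMass p X (X ω)) - ∑ ω, p ω := by
    rw [← Finset.sum_sub_distrib, ← Finset.sum_sub_distrib]
    refine Finset.sum_le_sum fun ω _ => ?_
    rcases (hp.1 ω).eq_or_lt with h0 | h0
    · simp [← h0]
    · have hm := h0.trans_le (le_valueMass hp.1 X ω)
      have := Real.log_le_sub_one_of_pos (div_pos (hpos ω h0) hm)
      rw [Real.log_div (hpos ω h0).ne' hm.ne'] at this
      nlinarith
  have h2 : ∑ ω, p ω * (r (X ω) / valueMass p X (X ω)) ≤ 1 := by
    rw [sum_mul_comp_eq p X fun x => r x / valueMass p X x]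
    refine le_trans (Finset.sum_le_sum fun x _ => ?_) hsum
    rcases eq_or_ne (valueMass p X x) 0 with h | h
    · simp [h, hr]
    · rw [mul_div_cancel₀ _ h]
  rw [hp.2] at key
  rw [natEntropy]
  linarith

lemma natEntropy_le_log_card {p : Ω → ℝ} (hp : p ∈ stdSimplex ℝ Ω) [Fintype β] (X : Ω → β) :
    natEntropy p X ≤ Real.log (Fintype.card β) := by
  classical
  have hpos : ∀ ω, 0 < p ω → 0 < ((Fintype.card β : ℝ))⁻¹ := fun ω _ => by
    have : Nonempty β := ⟨X ω⟩
    positivity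
  refine (natEntropy_le_of_subprobability hp X (fun _ => (Fintype.card β : ℝ)⁻¹)
    (fun _ => by positivity) hpos ?_).trans (le_of_eq ?_)
  · rw [Finset.sum_const, nsmul_eq_mul, ← div_eq_mul_inv]
    exact div_le_one_of_le₀ (by exact_mod_cast Finset.card_le_univ _) (by positivity)
  · rw [← Finset.sum_mul, hp.2, Real.log_inv]; ring

/-- Conditional mutual information is nonnegative. -/
lemma natEntropy_submodular {p : Ω → ℝ} (hp : p ∈ stdSimplex ℝ Ω) (X : Ω → β) (Y : Ω → γ)
    (Z : Ω → δ) :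
    natEntropy p (fun ω => (X ω, Y ω, Z ω)) + natEntropy p Z ≤
      natEntropy p (fun ω => (X ω, Z ω)) + natEntropy p (fun ω => (Y ω, Z ω)) := by
  classical
  set mXZ := valueMass p (fun ω => (X ω, Z ω))
  set mYZ := valueMass p (fun ω => (Y ω, Z ω))
  set mZ := valueMass p Z
  have nXZ : ∀ v, 0 ≤ mXZ v := valueMass_nonneg hp.1 _
  have nYZ : ∀ v, 0 ≤ mYZ v := valueMass_nonneg hp.1 _
  have nZ : ∀ v, 0 ≤ mZ v := valueMass_nonneg hp.1 _
  have pXZ : ∀ ω, 0 < p ω → 0 < mXZ (X ω, Z ω) := fun ω h =>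
    h.trans_le (le_valueMass hp.1 (fun ω => (X ω, Z ω)) ω)
  have pYZ : ∀ ω, 0 < p ω → 0 < mYZ (Y ω, Z ω) := fun ω h =>
    h.trans_le (le_valueMass hp.1 (fun ω => (Y ω, Z ω)) ω)
  have pZ : ∀ ω, 0 < p ω → 0 < mZ (Z ω) := fun ω h => h.trans_le (le_valueMass hp.1 Z ω)
  -- The reference law makes `X` and `Y` conditionally independent given `Z`.
  have key := natEntropy_le_of_subprobability hp (fun ω => (X ω, Y ω, Z ω))
    (fun v => mXZ (v.1, v.2.2) * mYZ (v.2.1, v.2.2) / mZ v.2.2)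
    (fun v => div_nonneg (mul_nonneg (nXZ _) (nYZ _)) (nZ _))
    (fun ω h => div_pos (mul_pos (pXZ ω h) (pYZ ω h)) (pZ ω h)) (by
      calc _ ≤ ∑ v ∈ (Finset.univ.image X) ×ˢ (Finset.univ.image Y) ×ˢ (Finset.univ.image Z),
            mXZ (v.1, v.2.2) * mYZ (v.2.1, v.2.2) / mZ v.2.2 := by
            refine Finset.sum_le_sum_of_subset_of_nonneg ?_ fun v _ _ =>
              div_nonneg (mul_nonneg (nXZ _) (nYZ _)) (nZ _)
            intro v hv
            rw [Finset.mem_image] at hv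
            obtain ⟨ω, -, rfl⟩ := hv
            simp
        _ = ∑ z ∈ Finset.univ.image Z, mZ z * mZ z / mZ z := by
            simp_rw [Finset.sum_product]
            rw [Finset.sum_congr rfl fun x _ => Finset.sum_comm, Finset.sum_comm]
            refine Finset.sum_congr rfl fun z _ => ?_
            simp_rw [← Finset.sum_div, ← Finset.mul_sum, ← Finset.sum_mul]
            simp only [mXZ, mYZ, mZ, sum_valueMass_prod]
        _ ≤ 1 := by
            rw [← sum_valueMass hp Z]
            refine Finset.sum_le_sum fun z _ => ?_
            rw [mul_self_div_self])
  have hlog : ∑ ω, p ω * Real.log (mXZ (X ω, Z ω) * mYZ (Y ω, Z ω) / mZ (Z ω)) =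
      ∑ ω, p ω * Real.log (mXZ (X ω, Z ω)) + ∑ ω, p ω * Real.log (mYZ (Y ω, Z ω)) -
        ∑ ω, p ω * Real.log (mZ (Z ω)) := by
    rw [← Finset.sum_add_distrib, ← Finset.sum_sub_distrib]
    refine Finset.sum_congr rfl fun ω _ => ?_
    rcases (hp.1 ω).eq_or_lt with h0 | h0
    · simp [← h0]
    · rw [Real.log_div (mul_pos (pXZ ω h0) (pYZ ω h0)).ne' (pZ ω h0).ne',
        Real.log_mul (pXZ ω h0).ne' (pYZ ω h0).ne']
      ring
  have e1 : natEntropy p Z = -∑ ω, p ω * Real.log (mZ (Z ω)) := rfl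
  have e2 : natEntropy p (fun ω => (X ω, Z ω)) = -∑ ω, p ω * Real.log (mXZ (X ω, Z ω)) := rfl
  have e3 : natEntropy p (fun ω => (Y ω, Z ω)) = -∑ ω, p ω * Real.log (mYZ (Y ω, Z ω)) := rfl
  simp only [hlog] at key
  linarith

/-- Fano's inequality, for the guess `g (Y ω)` of `X ω`. -/
lemma natEntropy_fano {p : Ω → ℝ} (hp : p ∈ stdSimplex ℝ Ω) [Fintype β] [DecidableEq β]
    (X : Ω → β) (Y : Ω → γ) (g : γ → β) :
    natEntropy p (fun ω => (X ω, Y ω)) ≤ natEntropy p Y + Real.log 2 +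
      (∑ ω, if g (Y ω) ≠ X ω then p ω else 0) * Real.log (Fintype.card β) := by
  classical
  set c : ℝ := (2 * (Fintype.card β : ℝ))⁻¹
  have hc : 0 ≤ c := by positivity
  have hcard : ∀ ω : Ω, (0 : ℝ) < Fintype.card β := fun ω => by
    have : Nonempty β := ⟨X ω⟩
    exact_mod_cast Fintype.card_pos
  -- Given `Y`, the reference law is half on the guess and half uniform.
  set q : β → γ → ℝ := fun x y => (if g y = x then 1 / 2 else 0) + c
  have hq : ∀ x y, 0 ≤ q x y := fun x y => by
    simp only [q]; split_ifs <;> positivity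
  have pY : ∀ ω, 0 < p ω → 0 < valueMass p Y (Y ω) := fun ω h => h.trans_le (le_valueMass hp.1 Y ω)
  have pc : ∀ ω : Ω, 0 < c := fun ω => by have := hcard ω; positivity
  have pq : ∀ ω, 0 < q (X ω) (Y ω) := fun ω => by
    have := pc ω
    simp only [q]; split_ifs <;> positivity
  have key := natEntropy_le_of_subprobability hp (fun ω => (X ω, Y ω))
    (fun v => valueMass p Y v.2 * q v.1 v.2)
    (fun v => mul_nonneg (valueMass_nonneg hp.1 _ _) (hq _ _))
    (fun ω h => mul_pos (pY ω h) (pq ω)) (by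
      calc _ ≤ ∑ v ∈ (Finset.univ : Finset β) ×ˢ (Finset.univ.image Y),
            valueMass p Y v.2 * q v.1 v.2 := by
            refine Finset.sum_le_sum_of_subset_of_nonneg ?_ fun v _ _ =>
              mul_nonneg (valueMass_nonneg hp.1 _ _) (hq _ _)
            intro v hv
            rw [Finset.mem_image] at hv
            obtain ⟨ω, -, rfl⟩ := hv
            simp
        _ = ∑ y ∈ Finset.univ.image Y, valueMass p Y y * ∑ x, q x y := by
            rw [Finset.sum_product, Finset.sum_comm]
            simp_rw [← Finset.mul_sum]
        _ ≤ ∑ y ∈ Finset.univ.image Y, valueMass p Y y * 1 := by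
            refine Finset.sum_le_sum fun y hy => mul_le_mul_of_nonneg_left ?_
              (valueMass_nonneg hp.1 _ _)
            obtain ⟨ω, -, rfl⟩ := Finset.mem_image.1 hy
            simp only [q, Finset.sum_add_distrib, Finset.sum_ite_eq, Finset.mem_univ, if_true,
              Finset.sum_const, Finset.card_univ, nsmul_eq_mul, c]
            have := hcard ω
            apply le_of_eq
            field_simp
            norm_num
        _ = 1 := by simp [sum_valueMass hp Y])
  have hlog : ∑ ω, p ω * Real.log (valueMass p Y (Y ω)) -
      ∑ ω, p ω * Real.log (valueMass p Y (Y ω) * q (X ω) (Y ω)) ≤ Real.log 2 +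
      (∑ ω, if g (Y ω) ≠ X ω then p ω else 0) * Real.log (Fintype.card β) := by
    have h2 : Real.log 2 = ∑ ω, p ω * Real.log 2 := by rw [← Finset.sum_mul, hp.2, one_mul]
    rw [h2, Finset.sum_mul, ← Finset.sum_sub_distrib, ← Finset.sum_add_distrib]
    refine Finset.sum_le_sum fun ω _ => ?_
    rcases (hp.1 ω).eq_or_lt with h0 | h0
    · simp [← h0]
    · rw [Real.log_mul (pY ω h0).ne' (pq ω).ne']
      have h3 : -Real.log (q (X ω) (Y ω)) ≤ Real.log 2 +
          if g (Y ω) ≠ X ω then Real.log (Fintype.card β) else 0 := by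
        by_cases hg : g (Y ω) = X ω
        · have : Real.log (1 / 2) ≤ Real.log (q (X ω) (Y ω)) :=
            Real.log_le_log (by norm_num) (by simp [q, hg, hc])
          rw [one_div, Real.log_inv] at this
          simp [hg]; linarith
        · simp only [q, hg, if_false, ne_eq, not_false_eq_true, if_true, c, zero_add]
          rw [Real.log_inv, Real.log_mul (by norm_num) (hcard ω).ne']
          simp
      split_ifs at h3 ⊢ <;> nlinarith
  have e1 : natEntropy p Y = -∑ ω, p ω * Real.log (valueMass p Y (Y ω)) := rfl
  simp only at key
  linarith

/-- The law of `n` independent copies. -/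
lemma iid_mem_stdSimplex {p : Ω → ℝ} (hp : p ∈ stdSimplex ℝ Ω) (n : ℕ) :
    (fun w : Fin n → Ω => ∏ t, p (w t)) ∈ stdSimplex ℝ (Fin n → Ω) := by
  refine ⟨fun w => Finset.prod_nonneg fun t _ => hp.1 _, ?_⟩
  rw [← Fintype.prod_sum fun (_ : Fin n) ω => p ω]
  simp [hp.2]

lemma sum_iid_mul {p : Ω → ℝ} (hp : p ∈ stdSimplex ℝ Ω) (n : ℕ) (f : Ω → ℝ) :
    ∑ w : Fin n → Ω, (∏ t, p (w t)) * ∑ t, f (w t) = n * ∑ ω, p ω * f ω := by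
  classical
  have h : ∀ t₀ : Fin n, ∑ w : Fin n → Ω, (∏ t, p (w t)) * f (w t₀) = ∑ ω, p ω * f ω := by
    intro t₀
    have h1 : ∀ w : Fin n → Ω, (∏ t, p (w t)) * f (w t₀) =
        ∏ t, (p (w t) * if t = t₀ then f (w t) else 1) := fun w => by
      rw [Finset.prod_mul_distrib]
      simp
    simp_rw [h1]
    rw [← Fintype.prod_sum fun (t : Fin n) ω => p ω * if t = t₀ then f ω else 1]
    rw [Finset.prod_eq_single t₀]
    · simp
    · intro t _ ht
      simp [ht, hp.2]
    · simp
  simp_rw [Finset.mul_sum]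
  rw [Finset.sum_comm, ← Finset.mul_sum, Finset.sum_congr rfl fun t _ => h t]
  simp

lemma natEntropy_iid {p : Ω → ℝ} (hp : p ∈ stdSimplex ℝ Ω) (n : ℕ) (X : Ω → β) :
    natEntropy (fun w : Fin n → Ω => ∏ t, p (w t)) (fun w t => X (w t)) =
      n * natEntropy p X := by
  classical
  have hm : ∀ w : Fin n → Ω, valueMass (fun w : Fin n → Ω => ∏ t, p (w t))
      (fun w t => X (w t)) (fun t => X (w t)) = ∏ t, valueMass p X (X (w t)) := by
    intro w
    simp only [valueMass]
    rw [Fintype.prod_sum fun (t : Fin n) ω => if X ω = X (w t) then p ω else 0]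
    refine Finset.sum_congr rfl fun w' _ => ?_
    rw [Finset.prod_ite_zero]
    simp [funext_iff]
  simp only [natEntropy, hm]
  rw [mul_neg, ← sum_iid_mul hp n fun ω => Real.log (valueMass p X (X ω))]
  congr 1
  refine Finset.sum_congr rfl fun w _ => ?_
  rcases eq_or_ne (∏ t, p (w t)) 0 with h | h
  · simp [h]
  · rw [Real.log_prod]
    intro t _
    have h0 : p (w t) ≠ 0 := Finset.prod_ne_zero_iff.1 h t (Finset.mem_univ t)
    exact (((hp.1 _).lt_of_ne' h0).trans_le (le_valueMass hp.1 X _)).ne'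

lemma PMF.toReal_mem_stdSimplex (P : PMF Ω) : (fun ω => (P ω).toReal) ∈ stdSimplex ℝ Ω := by
  refine ⟨fun ω => ENNReal.toReal_nonneg, ?_⟩
  rw [← ENNReal.toReal_sum fun ω _ => P.apply_ne_top ω]
  have := P.tsum_coe
  rw [tsum_fintype] at this
  simp [this]

lemma shannonEntropy_eq (P : PMF Ω) (X : Ω → β) :
    shannonEntropy P X = natEntropy (fun ω => (P ω).toReal) X / Real.log 2 := by
  classical
  have hm : ∀ x, (P.map X x).toReal = valueMass (fun ω => (P ω).toReal) X x := fun x => by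
    rw [PMF.map_apply, tsum_fintype, ENNReal.toReal_sum, valueMass]
    · refine Finset.sum_congr rfl fun ω _ => ?_
      by_cases h : X ω = x
      · simp [h]
      · simp [h, Ne.symm h]
    · intro ω _
      split_ifs
      · exact P.apply_ne_top ω
      · simp
  rw [shannonEntropy, ← Finset.sum_div, natEntropy,
    sum_mul_comp_eq _ X fun x => Real.log (valueMass (fun ω => (P ω).toReal) X x),
    ← Finset.sum_neg_distrib]
  congr 1
  convert Finset.sum_congr rfl fun x _ => ?_
  rw [hm, Real.negMulLog, neg_mul]

end Entropy

/-! ### Fourier–Motzkin elimination with integer coefficients -/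

section IntCone

variable {ι κ : Type*} [Fintype κ]

/-- A polyhedral cone cut out by finitely many homogeneous inequalities with integer
coefficients. -/
def IsIntCone (s : Set (κ → ℝ)) : Prop :=
  ∃ F : Finset (κ → ℤ), s = {t | ∀ a ∈ F, 0 ≤ ∑ k, (a k : ℝ) * t k}

/-- A linear functional with integer coefficients. -/
def IsIntLinear (f : (κ → ℝ) → ℝ) : Prop :=
  ∃ a : κ → ℤ, ∀ t, f t = ∑ k, (a k : ℝ) * t k

lemma IsIntLinear.apply (k : κ) : IsIntLinear fun t : κ → ℝ => t k := by
  classical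
  exact ⟨Pi.single k 1, fun t => by simp [Pi.single_apply]⟩

lemma IsIntLinear.add {f g : (κ → ℝ) → ℝ} (hf : IsIntLinear f) (hg : IsIntLinear g) :
    IsIntLinear fun t => f t + g t := by
  obtain ⟨a, ha⟩ := hf
  obtain ⟨b, hb⟩ := hg
  exact ⟨a + b, fun t => by simp [ha, hb, add_mul, Finset.sum_add_distrib]⟩

lemma IsIntLinear.sub {f g : (κ → ℝ) → ℝ} (hf : IsIntLinear f) (hg : IsIntLinear g) :
    IsIntLinear fun t => f t - g t := by
  obtain ⟨a, ha⟩ := hf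
  obtain ⟨b, hb⟩ := hg
  exact ⟨a - b, fun t => by simp [ha, hb, sub_mul, Finset.sum_sub_distrib]⟩

lemma IsIntLinear.zero : IsIntLinear fun _ : κ → ℝ => 0 :=
  ⟨0, fun t => by simp⟩

lemma IsIntLinear.isIntCone_le {f g : (κ → ℝ) → ℝ} (hf : IsIntLinear f) (hg : IsIntLinear g) :
    IsIntCone {t | f t ≤ g t} := by
  obtain ⟨a, ha⟩ := hg.sub hf
  refine ⟨{a}, ?_⟩
  ext t
  simp [← ha]

lemma IsIntCone.univ : IsIntCone {_t : κ → ℝ | True} := ⟨∅, by simp⟩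

lemma IsIntCone.and {P Q : (κ → ℝ) → Prop} (hP : IsIntCone {t | P t}) (hQ : IsIntCone {t | Q t}) :
    IsIntCone {t | P t ∧ Q t} := by
  classical
  obtain ⟨F, hF⟩ := hP
  obtain ⟨G, hG⟩ := hQ
  refine ⟨F ∪ G, ?_⟩
  rw [Set.ofPred_and, hF, hG]
  ext t
  simp only [Set.mem_inter_iff, Set.mem_ofPred_eq, Finset.mem_union]
  grind

lemma IsIntLinear.isIntCone_eq {f g : (κ → ℝ) → ℝ} (hf : IsIntLinear f) (hg : IsIntLinear g) :
    IsIntCone {t | f t = g t} := by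
  simpa only [le_antisymm_iff] using (hf.isIntCone_le hg).and (hg.isIntCone_le hf)

lemma IsIntCone.imp (p : Prop) {P : (κ → ℝ) → Prop} (hP : IsIntCone {t | P t}) :
    IsIntCone {t | p → P t} := by
  by_cases h : p
  · simpa [h] using hP
  · simpa [h] using IsIntCone.univ

lemma IsIntCone.forall [Finite ι] {P : ι → (κ → ℝ) → Prop} (hP : ∀ i, IsIntCone {t | P i t}) :
    IsIntCone {t | ∀ i, P i t} := by
  classical
  have := Fintype.ofFinite ι
  choose F hF using hP
  refine ⟨Finset.univ.biUnion F, ?_⟩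
  ext t
  have : ∀ i, P i t ↔ ∀ a ∈ F i, 0 ≤ ∑ k, (a k : ℝ) * t k := fun i => by
    simpa only [Set.mem_ofPred_eq] using Set.ext_iff.1 (hF i) t
  simp only [this, Set.mem_ofPred_eq, Finset.mem_biUnion, Finset.mem_univ, true_and]
  exact ⟨fun h a ⟨i, ha⟩ => h i a ha, fun h i a ha => h a ⟨i, ha⟩⟩

lemma exists_between_finsets {L U : Finset ℝ} (h : ∀ l ∈ L, ∀ u ∈ U, l ≤ u) :
    ∃ x, (∀ l ∈ L, l ≤ x) ∧ ∀ u ∈ U, x ≤ u := by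
  rcases L.eq_empty_or_nonempty with rfl | hL
  · obtain ⟨x, hx⟩ := U.finite_toSet.bddBelow
    exact ⟨x, by simp, hx⟩
  · exact ⟨L.max' hL, fun l hl => L.le_max' l hl, h _ (L.max'_mem hL)⟩

/-- Elimination of one variable: each inequality bounding it from below is combined with each
inequality bounding it from above. -/
lemma IsIntCone.exists_option {s : Set (Option κ → ℝ)} (hs : IsIntCone s) :
    IsIntCone {t : κ → ℝ | ∃ x : ℝ, (fun o : Option κ => o.elim x t) ∈ s} := by
  classical
  obtain ⟨F, rfl⟩ := hs
  let φ : (Option κ → ℤ) → (κ → ℝ) → ℝ := fun a t => ∑ k, (a (some k) : ℝ) * t k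
  refine ⟨(F.filter fun a => a none = 0).image (fun a k => a (some k)) ∪
    ((F.filter fun a => 0 < a none) ×ˢ (F.filter fun a => a none < 0)).image
      (fun ab k => -ab.2 none * ab.1 (some k) + ab.1 none * ab.2 (some k)), ?_⟩
  ext t
  have hcomb : ∀ a b : Option κ → ℤ,
      ∑ k, ((-b none * a (some k) + a none * b (some k) : ℤ) : ℝ) * t k =
        -(b none : ℝ) * φ a t + a none * φ b t := fun a b => by
    simp only [φ, Finset.mul_sum, ← Finset.sum_add_distrib]
    refine Finset.sum_congr rfl fun k _ => ?_
    push_cast; ring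
  simp only [Set.mem_ofPred_eq, Fintype.sum_option, Option.elim_none, Option.elim_some,
    Finset.mem_union, Finset.mem_image, Finset.mem_filter, Finset.mem_product, Prod.exists]
  constructor
  · rintro ⟨x, hx⟩ c (⟨a, ⟨ha, h0⟩, rfl⟩ | ⟨a, b, ⟨⟨ha, h0⟩, hb, h1⟩, rfl⟩)
    · simpa [h0] using hx a ha
    · rw [hcomb]
      have ha' : 0 ≤ a none * x + φ a t := hx a ha
      have hb' : 0 ≤ b none * x + φ b t := hx b hb
      have h0' : (0 : ℝ) < a none := by exact_mod_cast h0
      have h1' : (b none : ℝ) < 0 := by exact_mod_cast h1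
      nlinarith [mul_nonneg h0'.le hb', mul_nonneg (neg_nonneg.2 h1'.le) ha']
  · intro h
    obtain ⟨x, hL, hU⟩ := exists_between_finsets
      (L := (F.filter fun a => 0 < a none).image fun a => -φ a t / a none)
      (U := (F.filter fun a => a none < 0).image fun a => φ a t / -a none) (by
        simp only [Finset.mem_image, Finset.mem_filter]
        rintro _ ⟨a, ⟨ha, h0⟩, rfl⟩ _ ⟨b, ⟨hb, h1⟩, rfl⟩
        have h0' : (0 : ℝ) < a none := by exact_mod_cast h0
        have h1' : (b none : ℝ) < 0 := by exact_mod_cast h1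
        have := h _ (Or.inr ⟨a, b, ⟨⟨ha, h0⟩, hb, h1⟩, rfl⟩)
        rw [hcomb] at this
        rw [div_le_div_iff₀ h0' (by linarith)]
        linarith)
    refine ⟨x, fun a ha => ?_⟩
    change 0 ≤ a none * x + φ a t
    rcases lt_trichotomy (a none) 0 with h0 | h0 | h0
    · have h0' : (a none : ℝ) < 0 := by exact_mod_cast h0
      have := hU _ (Finset.mem_image.2 ⟨a, by simp [ha, h0], rfl⟩)
      rw [le_div_iff₀ (by linarith)] at this
      linarith
    · have := h _ (Or.inl ⟨a, ⟨ha, h0⟩, rfl⟩)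
      simpa [h0] using this
    · have h0' : (0 : ℝ) < a none := by exact_mod_cast h0
      have := hL _ (Finset.mem_image.2 ⟨a, by simp [ha, h0], rfl⟩)
      rw [div_le_iff₀ h0'] at this
      linarith

lemma IsIntCone.comp_equiv {κ' : Type*} [Fintype κ'] (e : κ ≃ κ') {s : Set (κ → ℝ)}
    (hs : IsIntCone s) : IsIntCone {t : κ' → ℝ | (fun k => t (e k)) ∈ s} := by
  classical
  obtain ⟨F, rfl⟩ := hs
  refine ⟨F.image fun a k => a (e.symm k), ?_⟩
  ext t
  simp only [Set.mem_ofPred_eq, Finset.mem_image, forall_exists_index, and_imp,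
    forall_apply_eq_imp_iff₂]
  refine forall₂_congr fun a _ => ?_
  rw [← Equiv.sum_comp e fun k => (a (e.symm k) : ℝ) * t k]
  simp

/-- The projection of an integer cone that forgets finitely many coordinates is an integer
cone. -/
lemma IsIntCone.exists_sum : ∀ (n : ℕ) {s : Set (Fin n ⊕ κ → ℝ)}, IsIntCone s →
    IsIntCone {t : κ → ℝ | ∃ h : Fin n → ℝ, Sum.elim h t ∈ s}
  | 0, s, hs => by
    have := hs.comp_equiv (Equiv.emptySum (Fin 0) κ)
    convert this using 3 with t
    constructor
    · rintro ⟨h, hh⟩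
      refine (congrArg (· ∈ s) ?_).mp hh
      ext (k | k)
      · exact k.elim0
      · rfl
    · intro hh
      refine ⟨Fin.elim0, ?_⟩
      refine (congrArg (· ∈ s) ?_).mp hh
      ext (k | k)
      · exact k.elim0
      · rfl
  | n + 1, s, hs => by
    let e : Fin (n + 1) ⊕ κ ≃ Option (Fin n ⊕ κ) :=
      { toFun := Sum.elim (Fin.cases none fun i => some (Sum.inl i)) fun k => some (Sum.inr k)
        invFun := fun o => o.elim (Sum.inl 0) (Sum.elim (fun i => Sum.inl i.succ) Sum.inr)
        left_inv := by
          rintro (k | k)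
          · refine Fin.cases ?_ (fun i => ?_) k <;> simp
          · simp
        right_inv := by rintro (_ | k | k) <;> simp }
    have := IsIntCone.exists_sum n (hs.comp_equiv e).exists_option
    convert this using 3 with t
    constructor
    · rintro ⟨h, hh⟩
      refine ⟨fun i => h i.succ, h 0, ?_⟩
      refine (congrArg (· ∈ s) ?_).mp hh
      ext (k | k)
      · refine Fin.cases ?_ (fun i => ?_) k <;> simp [e]
      · simp [e]
    · rintro ⟨h, x, hh⟩
      refine ⟨Fin.cases x h, ?_⟩
      refine (congrArg (· ∈ s) ?_).mp hh
      ext (k | k)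
      · refine Fin.cases ?_ (fun i => ?_) k <;> simp [e]
      · simp [e]

lemma IsIntCone.exists_finite [Fintype ι] {s : Set (ι ⊕ κ → ℝ)} (hs : IsIntCone s) :
    IsIntCone {t : κ → ℝ | ∃ h : ι → ℝ, Sum.elim h t ∈ s} := by
  let e := Fintype.equivFin ι
  have := IsIntCone.exists_sum _ (hs.comp_equiv (e.sumCongr (Equiv.refl κ)))
  convert this using 3 with t
  constructor
  · rintro ⟨h, hh⟩
    refine ⟨fun i => h (e.symm i), ?_⟩
    refine (congrArg (· ∈ s) ?_).mp hh
    ext (k | k) <;> simp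
  · rintro ⟨h, hh⟩
    refine ⟨fun i => h (e i), ?_⟩
    refine (congrArg (· ∈ s) ?_).mp hh
    ext (k | k) <;> simp

end IntCone

/-! ### Entropic functions and their closure -/

section Entropic

variable {Ω G β : Type*}

/-- A canonical sample point with the same value of `f`: a random variable with the fibres of `f`
and values in the sample space itself. -/
noncomputable def fiberRep (f : Ω → β) (ω : Ω) : Ω :=
  haveI : Nonempty Ω := ⟨ω⟩
  Function.invFun f (f ω)

lemma apply_fiberRep (f : Ω → β) (ω : Ω) : f (fiberRep f ω) = f ω :=
  haveI : Nonempty Ω := ⟨ω⟩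
  Function.invFun_eq ⟨ω, rfl⟩

lemma fiberRep_eq_iff (f : Ω → β) (ω ω' : Ω) : fiberRep f ω = fiberRep f ω' ↔ f ω = f ω' := by
  constructor
  · intro h
    rw [← apply_fiberRep f ω, h, apply_fiberRep f]
  · intro h
    simp only [fiberRep, h]

variable [Fintype Ω]

/-- The entropies, in nats, of all subfamilies of a family of random variables. -/
noncomputable def jointEntropy (p : Ω → ℝ) (Z : G → Ω → β) (α : Set G) : ℝ :=
  natEntropy p fun ω (i : α) => Z i ω

lemma jointEntropy_eq (p : Ω → ℝ) (Z : G → Ω → β) (α : Set G) {γ : Type*} (X : Ω → γ)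
    (h : ∀ ω ω', (∀ i ∈ α, Z i ω = Z i ω') ↔ X ω = X ω') :
    jointEntropy p Z α = natEntropy p X :=
  natEntropy_congr p fun ω ω' => by simp [funext_iff, ← h]

lemma jointEntropy_congr (p : Ω → ℝ) (Z : G → Ω → β) {α α' : Set G}
    (h : ∀ ω ω', (∀ i ∈ α, Z i ω = Z i ω') ↔ ∀ i ∈ α', Z i ω = Z i ω') :
    jointEntropy p Z α = jointEntropy p Z α' :=
  jointEntropy_eq p Z α _ fun ω ω' => by simp [funext_iff, h]

lemma jointEntropy_empty {p : Ω → ℝ} (hp : p ∈ stdSimplex ℝ Ω) (Z : G → Ω → β) :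
    jointEntropy p Z ∅ = 0 :=
  natEntropy_of_subsingleton hp _

lemma jointEntropy_mem_polymatroids {p : Ω → ℝ} (hp : p ∈ stdSimplex ℝ Ω) (Z : G → Ω → β) :
    jointEntropy p Z ∈ polymatroids G := by
  refine ⟨jointEntropy_empty hp Z, fun α α' h => ?_, fun α α' => ?_⟩
  · refine natEntropy_mono hp.1 fun ω ω' he => ?_
    simp only [funext_iff, Subtype.forall] at he ⊢
    exact fun i hi => he i (h hi)
  · have := natEntropy_submodular hp (fun ω (i : α) => Z i ω) (fun ω (i : α') => Z i ω)
      (fun ω (i : ↥(α ∩ α')) => Z i ω)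
    rw [← jointEntropy_eq p Z (α ∪ α'), ← jointEntropy_eq p Z (α ∩ α'),
      ← jointEntropy_eq p Z α, ← jointEntropy_eq p Z α'] at this
    · exact this
    all_goals
      intro ω ω'
      simp only [Prod.mk.injEq, funext_iff, Subtype.forall, Set.mem_union, Set.mem_inter_iff] <;>
        grind

/-- Entropic functions may be realized on any finite sample space with any alphabets. -/
lemma jointEntropy_div_log_two_mem_entropicFunctions {p : Ω → ℝ} (hp : p ∈ stdSimplex ℝ Ω)
    (Z : G → Ω → β) : (fun α => jointEntropy p Z α / Real.log 2) ∈ entropicFunctions G := by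
  let e := Fintype.equivFin Ω
  let P : PMF Ω := PMF.ofFintype (fun ω => ENNReal.ofReal (p ω)) (by
    rw [← ENNReal.ofReal_sum_of_nonneg fun ω _ => hp.1 ω, hp.2, ENNReal.ofReal_one])
  have hP : (fun ω => (P ω).toReal) = p := by
    ext ω
    simp [P, hp.1]
  refine ⟨Fintype.card Ω, P.map e, fun i k => e (fiberRep (Z i) (e.symm k)), fun α => ?_⟩
  rw [shannonEntropy_eq]
  refine congrArg (· / Real.log 2) ?_
  have hmap : ∀ k, ((P.map e) k).toReal = p (e.symm k) := fun k => by
    rw [← hP]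
    congr 1
    obtain ⟨ω, rfl⟩ := e.surjective k
    rw [PMF.map_apply, tsum_eq_single ω]
    · simp
    · intro ω' h
      simp [e.injective.eq_iff, Ne.symm h]
  simp only [hmap]
  rw [jointEntropy, natEntropy, natEntropy, neg_inj, ← Equiv.sum_comp e.symm]
  refine Finset.sum_congr rfl fun k _ => ?_
  congr 2
  rw [valueMass, valueMass, ← Equiv.sum_comp e.symm]
  classical
  refine Finset.sum_congr rfl fun k' _ => if_congr ?_ rfl rfl
  simp [funext_iff, Fin.val_inj, fiberRep_eq_iff]

lemma entropicFunctions_subset_polymatroids : entropicFunctions G ⊆ polymatroids G := by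
  rintro h ⟨m, p, Z, hZ⟩
  have hlog : 0 < Real.log 2 := Real.log_pos (by norm_num)
  obtain ⟨h0, h1, h2⟩ := jointEntropy_mem_polymatroids p.toReal_mem_stdSimplex Z
  have he : ∀ α, h α = jointEntropy (fun ω => (p ω).toReal) Z α / Real.log 2 := fun α => by
    rw [hZ, shannonEntropy_eq]; rfl
  refine ⟨by rw [he, h0, zero_div], fun α β hab => ?_, fun α β => ?_⟩
  · rw [he, he]
    exact div_le_div_of_nonneg_right (h1 α β hab) hlog.le
  · rw [he, he, he, he, ← add_div, ← add_div]
    exact div_le_div_of_nonneg_right (h2 α β) hlog.le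

lemma isClosed_polymatroids : IsClosed (polymatroids G) := by
  have he : ∀ α : Set G, Continuous fun h : Set G → ℝ => h α := fun α => continuous_apply α
  simp only [polymatroids, Set.ofPred_and, Set.ofPred_forall]
  exact (isClosed_eq (he _) continuous_const).inter
    ((isClosed_iInter fun α => isClosed_iInter fun β => isClosed_iInter fun _ =>
        isClosed_le (he _) (he _)).inter
      (isClosed_iInter fun α => isClosed_iInter fun β =>
        isClosed_le ((he _).add (he _)) ((he _).add (he _))))

lemma almostEntropicFunctions_subset_polymatroids :
    almostEntropicFunctions G ⊆ polymatroids G :=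
  closure_minimal entropicFunctions_subset_polymatroids isClosed_polymatroids

/-- The weights that select an extra point with probability `1 - δ` and follow `p` otherwise. -/
def dilute (δ : ℝ) (p : Ω → ℝ) : Option Ω → ℝ
  | none => 1 - δ
  | some ω => δ * p ω

lemma dilute_mem_stdSimplex {p : Ω → ℝ} (hp : p ∈ stdSimplex ℝ Ω) {δ : ℝ} (h0 : 0 ≤ δ)
    (h1 : δ ≤ 1) : dilute δ p ∈ stdSimplex ℝ (Option Ω) := by
  refine ⟨?_, ?_⟩
  · rintro (_ | ω)
    · exact sub_nonneg.2 h1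
    · exact mul_nonneg h0 (hp.1 ω)
  · rw [Fintype.sum_option]
    simp [dilute, ← Finset.mul_sum, hp.2]

/-- Switching a nonempty family of variables on with probability `δ` scales its joint entropy by
`δ` and adds the entropy of the switch, which every variable reveals through `none`. -/
lemma jointEntropy_dilute {p : Ω → ℝ} (hp : p ∈ stdSimplex ℝ Ω) {δ : ℝ} (h0 : 0 ≤ δ)
    (Z : G → Ω → β) {α : Set G} (hα : α.Nonempty) :
    jointEntropy (dilute δ p) (fun i => Option.map (Z i)) α =
      Real.binEntropy δ + δ * jointEntropy p Z α := by
  obtain ⟨i₀, hi₀⟩ := hα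
  have hnone : valueMass (dilute δ p) (fun ω (i : α) => Option.map (Z i) ω)
      (fun i : α => Option.map (Z i) none) = 1 - δ := by
    rw [valueMass, Fintype.sum_option]
    simp only [dilute, if_true]
    rw [Finset.sum_eq_zero, add_zero]
    intro ω _
    rw [if_neg]
    intro h
    simpa using congrFun h ⟨i₀, hi₀⟩
  have hsome : ∀ ω, valueMass (dilute δ p) (fun ω (i : α) => Option.map (Z i) ω)
      (fun i : α => Option.map (Z i) (some ω)) =
        δ * valueMass p (fun ω (i : α) => Z i ω) (fun i : α => Z i ω) := fun ω => by
    rw [valueMass, Fintype.sum_option, if_neg, zero_add, valueMass, Finset.mul_sum]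
    · refine Finset.sum_congr rfl fun ω' _ => ?_
      rw [mul_ite, mul_zero]
      classical
      refine if_congr ?_ rfl rfl
      simp [funext_iff, (Option.some_injective β).eq_iff]
    · intro h
      simpa using congrFun h ⟨i₀, hi₀⟩
  rw [jointEntropy, natEntropy, Fintype.sum_option, hnone]
  simp only [hsome, dilute]
  have h2 : ∑ ω, δ * p ω * Real.log (δ * valueMass p (fun ω (i : α) => Z i ω)
      (fun i : α => Z i ω)) = δ * Real.log δ - δ * jointEntropy p Z α := by
    rw [jointEntropy, natEntropy, mul_neg, sub_neg_eq_add, Finset.mul_sum]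
    have : δ * Real.log δ = ∑ ω, δ * Real.log δ * p ω := by rw [← Finset.mul_sum, hp.2, mul_one]
    rw [this, ← Finset.sum_add_distrib]
    refine Finset.sum_congr rfl fun ω _ => ?_
    rcases (hp.1 ω).eq_or_lt with h | h
    · simp [← h]
    rcases h0.eq_or_lt with hδ | hδ
    · simp [← hδ]
    rw [Real.log_mul hδ.ne' (h.trans_le (le_valueMass hp.1 (fun ω (i : α) => Z i ω) ω)).ne']
    ring
  rw [h2, Real.binEntropy, Real.log_inv, Real.log_inv]
  ring

/-- Scaled-down entropic functions are almost entropic: `k` independent copies, switched on with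
probability `c / k`, have joint entropies tending to `c` times those of a single copy. -/
lemma smul_jointEntropy_mem_almostEntropicFunctions {p : Ω → ℝ} (hp : p ∈ stdSimplex ℝ Ω)
    (Z : G → Ω → β) {c : ℝ} (hc0 : 0 ≤ c) (hc1 : c ≤ 1) :
    (fun α => c * (jointEntropy p Z α / Real.log 2)) ∈ almostEntropicFunctions G := by
  let q : (k : ℕ) → (Fin (k + 1) → Ω) → ℝ := fun k w => ∏ t, p (w t)
  let Zk : (k : ℕ) → G → (Fin (k + 1) → Ω) → (Fin (k + 1) → β) := fun k i w t => Z i (w t)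
  have hδ0 : ∀ k : ℕ, 0 ≤ c / ((k : ℝ) + 1) := fun k => by positivity
  have hδ1 : ∀ k : ℕ, c / ((k : ℝ) + 1) ≤ 1 := fun k =>
    div_le_one_of_le₀ (by linarith [(k.cast_nonneg : (0 : ℝ) ≤ k)]) (by positivity)
  have hq : ∀ k, q k ∈ stdSimplex ℝ (Fin (k + 1) → Ω) := fun k => iid_mem_stdSimplex hp _
  refine mem_closure_of_tendsto (b := atTop) (f := fun k : ℕ => fun α =>
    jointEntropy (dilute (c / ((k : ℝ) + 1)) (q k)) (fun i => Option.map (Zk k i)) α /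
      Real.log 2) ?_ (Eventually.of_forall fun k =>
        jointEntropy_div_log_two_mem_entropicFunctions
          (dilute_mem_stdSimplex (hq k) (hδ0 k) (hδ1 k)) _)
  rw [tendsto_pi_nhds]
  intro α
  rcases α.eq_empty_or_nonempty with rfl | hα
  · simp_rw [jointEntropy_empty hp, jointEntropy_empty
      (dilute_mem_stdSimplex (hq _) (hδ0 _) (hδ1 _))]
    simp
  · have h1 : ∀ k : ℕ, jointEntropy (dilute (c / ((k : ℝ) + 1)) (q k))
        (fun i => Option.map (Zk k i)) α =
        Real.binEntropy (c / ((k : ℝ) + 1)) + c * jointEntropy p Z α := fun k => by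
      rw [jointEntropy_dilute (hq k) (hδ0 k) _ hα]
      have h2 : jointEntropy (q k) (Zk k) α = ((k + 1 : ℕ) : ℝ) * jointEntropy p Z α := by
        rw [jointEntropy.eq_def p, ← natEntropy_iid hp]
        refine jointEntropy_eq _ _ _ _ fun w w' => ?_
        simp only [Zk, funext_iff, Subtype.forall]
        exact ⟨fun h t i hi => h i hi t, fun h i hi t => h t i hi⟩
      rw [h2]
      push_cast
      field_simp
    simp only [h1]
    have hlim : Tendsto (fun k : ℕ => c / ((k : ℝ) + 1)) atTop (𝓝 0) := by
      simpa [div_eq_mul_inv] using tendsto_one_div_add_atTop_nhds_zero_nat.const_mul c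
    have := (Real.binEntropy_continuous.tendsto 0).comp hlim
    rw [Real.binEntropy_zero] at this
    have := (this.add_const (c * jointEntropy p Z α)).div_const (Real.log 2)
    rw [zero_add, mul_div_assoc] at this
    exact this

end Entropic

/-! ### The variables of a block code -/

instance {S L E : Type*} [Finite S] [Finite L] [Finite E] : Finite (NetVar S L E) :=
  Finite.of_injective (β := S ⊕ L ⊕ E)
    (fun | .X s => .inl s | .B l => .inr (.inl l) | .U e => .inr (.inr e))
    (by rintro (_ | _ | _) (_ | _ | _) h <;> simp_all)

lemma outerRegion_mono {V E S : Type*} [Fintype S] [DecidableEq S] {A : S → Type*}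
    [∀ s, Fintype (A s)] [∀ s, DecidableEq (A s)] (N : Network V E S) (T : Finset (∀ s, A s))
    (P : PMF (∀ s, A s)) {Δ Δ' : Set (Set (NetVar S (PartitionLabel T) E) → ℝ)} (h : Δ ⊆ Δ') :
    outerRegion N T P Δ ⊆ outerRegion N T P Δ' :=
  fun _ ⟨g, hg, hC⟩ => ⟨g, h hg, hC⟩

/-- In a polymatroid, variables that are singly determined by `β` are jointly so. -/
lemma polymatroids_image_union_eq {G ι : Type*} {h : Set G → ℝ} (hh : h ∈ polymatroids G)
    (f : ι → G) (β : Set G) {s : Set ι} (hs : s.Finite) (hd : ∀ i ∈ s, h ({f i} ∪ β) = h β) :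
    h (f '' s ∪ β) = h β := by
  obtain ⟨-, hmono, hsub⟩ := hh
  induction s, hs using Set.Finite.induction_on with
  | empty => simp
  | @insert i s _ _ ih =>
    have h1 := ih fun j hj => hd j (Set.mem_insert_of_mem _ hj)
    have h2 := hd i (Set.mem_insert _ _)
    have h3 := hsub ({f i} ∪ β) (f '' s ∪ β)
    have h4 := hmono β (({f i} ∪ β) ∩ (f '' s ∪ β)) (by grind)
    have h5 : {f i} ∪ β ∪ (f '' s ∪ β) = f '' insert i s ∪ β := by
      rw [Set.image_insert_eq]
      ext x
      simp only [Set.mem_union, Set.mem_insert_iff, Set.mem_singleton_iff]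
      tauto
    have h6 := hmono β (f '' insert i s ∪ β) Set.subset_union_right
    rw [h5] at h3
    linarith

section Block

variable {V E S : Type*} {A : S → Type*} {N : Network V E S} {n : ℕ}

lemma blockLaw_mem_stdSimplex [Fintype S] [DecidableEq S] [∀ s, Fintype (A s)]
    (P : PMF (∀ s, A s)) :
    (fun w : Fin n → ∀ s, A s => ∏ t, (P (w t)).toReal) ∈ stdSimplex ℝ (Fin n → ∀ s, A s) :=
  iid_mem_stdSimplex P.toReal_mem_stdSimplex n

variable [∀ s, DecidableEq (A s)]

/-- The random variables of a block code, on the space of `n` successive source vectors: source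
blocks, blocks of partition variables and edge messages, each replaced by its fibre representative
so that all have one alphabet. -/
noncomputable def blockVariable (T : Finset (∀ s, A s)) (c : N.BlockCode A n) :
    NetVar S (PartitionLabel T) E → (Fin n → ∀ s, A s) → (Fin n → ∀ s, A s)
  | .X s => fiberRep fun w t => w t s
  | .B l => fiberRep fun w t => l.var (w t)
  | .U e => fiberRep fun w => c.edge (fun s t => w t s) e

/-- What a node at `v` sees, as equality of the source blocks and the entering messages. -/
lemma blockVariable_eq_on_inputs_iff (T : Finset (∀ s, A s)) (c : N.BlockCode A n) (v : V)
    (w w' : Fin n → ∀ s, A s) :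
    (∀ i ∈ (NetVar.X '' N.sourcesAt v ∪ NetVar.U '' N.edgesInto v :
        Set (NetVar S (PartitionLabel T) E)), blockVariable T c i w = blockVariable T c i w') ↔
      (fun (s : N.sourcesAt v) t => w t s) = (fun (s : N.sourcesAt v) t => w' t s) ∧
      (fun f : N.edgesInto v => c.edge (fun s t => w t s) f) =
        (fun f : N.edgesInto v => c.edge (fun s t => w' t s) f) := by
  simp only [Set.mem_union, or_imp, forall_and, Set.forall_mem_image, blockVariable,
    fiberRep_eq_iff]
  simp only [funext_iff, Subtype.forall]

variable [Fintype S] [DecidableEq S] [∀ s, Fintype (A s)]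

/-- The joint entropies, in nats, of the variables of a block code. -/
noncomputable def blockEntropy (T : Finset (∀ s, A s)) (c : N.BlockCode A n)
    (P : PMF (∀ s, A s)) : Set (NetVar S (PartitionLabel T) E) → ℝ :=
  jointEntropy (fun w : Fin n → ∀ s, A s => ∏ t, (P (w t)).toReal) (blockVariable T c)

variable (T : Finset (∀ s, A s)) (c : N.BlockCode A n) (P : PMF (∀ s, A s))

lemma blockEntropy_nonneg (α : Set (NetVar S (PartitionLabel T) E)) : 0 ≤ blockEntropy T c P α :=
  natEntropy_nonneg (blockLaw_mem_stdSimplex P) _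

lemma blockEntropy_le (α : Set (NetVar S (PartitionLabel T) E)) :
    blockEntropy T c P α ≤ n * natEntropy (fun y => (P y).toReal) id := by
  rw [← natEntropy_iid P.toReal_mem_stdSimplex n id]
  refine natEntropy_mono (blockLaw_mem_stdSimplex P).1 fun w w' h => ?_
  rw [show w = w' from h]

lemma blockEntropy_source (W : Finset S) (Z : Finset (PartitionLabel T)) :
    blockEntropy T c P (NetVar.X '' (W : Set S) ∪ NetVar.B '' (Z : Set (PartitionLabel T))) =
      n * (sourceEntropy P W Z * Real.log 2) := by
  rw [sourceEntropy, shannonEntropy_eq, div_mul_cancel₀ _ (Real.log_pos (by norm_num)).ne',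
    ← natEntropy_iid P.toReal_mem_stdSimplex n]
  refine jointEntropy_eq _ _ _ _ fun w w' => ?_
  simp only [Set.mem_union, or_imp, forall_and, Set.forall_mem_image, blockVariable,
    fiberRep_eq_iff]
  simp only [funext_iff, Prod.mk.injEq, Subtype.forall, Finset.restrict, Finset.mem_coe,
    forall_and]
  exact ⟨fun h => ⟨fun t s hs => h.1 hs t, fun t l hl => h.2 hl t⟩,
    fun h => ⟨fun s hs t => h.1 t s hs, fun l hl t => h.2 t l hl⟩⟩

lemma blockEntropy_encode (e : E) :
    blockEntropy T c P ({NetVar.U e} ∪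
        (NetVar.X '' N.sourcesAt (N.tail e) ∪ NetVar.U '' N.edgesInto (N.tail e))) =
      blockEntropy T c P
        (NetVar.X '' N.sourcesAt (N.tail e) ∪ NetVar.U '' N.edgesInto (N.tail e)) := by
  refine jointEntropy_congr _ _ fun w w' => ?_
  refine ⟨fun h i hi => h i (Or.inr hi), fun h i hi => ?_⟩
  rcases hi with rfl | hi
  · obtain ⟨h1, h2⟩ := (blockVariable_eq_on_inputs_iff T c _ w w').1 h
    simp only [blockVariable, fiberRep_eq_iff]
    rw [c.edge_eq, c.edge_eq, h1, h2]
  · exact h i hi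

lemma errorProb_eq (s : S) (u : V) (hu : u ∈ N.dst s) :
    c.errorProb P s u hu = ∑ w : Fin n → ∀ s, A s,
      if c.dec s u hu (fun s' t => w t s') (fun f => c.edge (fun s t => w t s) f) ≠
        (fun t => w t s) then ∏ t, (P (w t)).toReal else 0 := by
  rw [Network.BlockCode.errorProb]
  refine @Fintype.sum_equiv _ _ _ (_) (_) _ (Equiv.piComm _) _ _ fun y => ?_
  exact ite_congr rfl (fun _ => rfl) fun _ => rfl

lemma blockEntropy_decode (s : S) (u : V) (hu : u ∈ N.dst s) :
    blockEntropy T c P ({NetVar.X s} ∪ (NetVar.X '' N.sourcesAt u ∪ NetVar.U '' N.edgesInto u)) ≤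
      blockEntropy T c P (NetVar.X '' N.sourcesAt u ∪ NetVar.U '' N.edgesInto u) + Real.log 2 +
        c.errorProb P s u hu * (n * Real.log (Fintype.card (A s))) := by
  have := natEntropy_fano (blockLaw_mem_stdSimplex P (n := n)) (fun w t => w t s)
    (fun w => ((fun (s' : N.sourcesAt u) t => w t s'),
      fun f : N.edgesInto u => c.edge (fun s t => w t s) f))
    (fun v => c.dec s u hu v.1 v.2)
  rw [Fintype.card_fun, Fintype.card_fin, Nat.cast_pow, Real.log_pow] at this
  rw [blockEntropy, errorProb_eq, jointEntropy_eq _ _ _ _ fun w w' =>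
    (blockVariable_eq_on_inputs_iff T c u w w').trans Prod.mk_inj.symm]
  refine le_trans (le_of_eq ?_) (this.trans (le_of_eq ?_))
  · refine jointEntropy_eq _ _ _ _ fun w w' => ?_
    rw [Prod.mk_inj, Prod.mk_inj, ← blockVariable_eq_on_inputs_iff T c u w w']
    simp only [Set.singleton_union, Set.forall_mem_insert, blockVariable, fiberRep_eq_iff]
  · rfl

lemma blockEntropy_edge_le (e : E) :
    blockEntropy T c P {NetVar.U e} ≤ Real.log (c.size e) := by
  have := natEntropy_le_log_card (blockLaw_mem_stdSimplex P (n := n))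
    (fun w => c.edge (fun s t => w t s) e)
  rw [Fintype.card_fin] at this
  refine le_trans (le_of_eq ?_) this
  refine jointEntropy_eq _ _ _ _ fun w w' => ?_
  simp [blockVariable, fiberRep_eq_iff]

end Block

/-! ### Achievable tuples lie in the outer region -/

/-- A limit point of the normalized joint entropies of the codes is the required `h`. -/
theorem achievable_subset_outerRegion {V E S : Type*} [Finite E] [Fintype S] [DecidableEq S]
    {A : S → Type*} [∀ s, Fintype (A s)] [∀ s, DecidableEq (A s)] (N : Network V E S)
    (T : Finset (∀ s, A s)) (P : PMF (∀ s, A s)) :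
    N.achievable P ⊆
      outerRegion N T P (almostEntropicFunctions (NetVar S (PartitionLabel T) E)) := by
  rintro C ⟨c, hrate, herr⟩
  have hlog : 0 < Real.log 2 := Real.log_pos (by norm_num)
  -- At block length `0` the factor `(0 : ℝ)⁻¹ = 0` makes `g 0` vanish, which is still almost
  -- entropic and bounded.
  let g : ℕ → Set (NetVar S (PartitionLabel T) E) → ℝ := fun n α =>
    (n : ℝ)⁻¹ * (blockEntropy T (c n) P α / Real.log 2)
  have hg : ∀ n, g n ∈ almostEntropicFunctions (NetVar S (PartitionLabel T) E) := fun n =>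
    smul_jointEntropy_mem_almostEntropicFunctions (blockLaw_mem_stdSimplex P) _
      (by positivity) (Nat.cast_inv_le_one n)
  set b := natEntropy (fun y => (P y).toReal) id / Real.log 2
  have hb : 0 ≤ b := div_nonneg (natEntropy_nonneg P.toReal_mem_stdSimplex _) hlog.le
  have hmem : ∀ n, g n ∈ Set.univ.pi fun _ => Set.Icc 0 b := fun n α _ => by
    refine ⟨mul_nonneg (by positivity) (div_nonneg (blockEntropy_nonneg _ _ _ _) hlog.le), ?_⟩
    rcases n.eq_zero_or_pos with rfl | hn
    · simpa [g] using hb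
    · have hn' : (0 : ℝ) < n := by exact_mod_cast hn
      rw [inv_mul_le_iff₀ hn', ← mul_div_assoc]
      exact div_le_div_of_nonneg_right (blockEntropy_le T (c n) P α) hlog.le
  obtain ⟨h, -, φ, hφ, hlim⟩ :=
    (isCompact_univ_pi fun _ => isCompact_Icc).tendsto_subseq hmem
  have hlim' : ∀ α, Tendsto (fun k => g (φ k) α) atTop (𝓝 (h α)) := fun α =>
    (tendsto_pi_nhds.1 hlim) α
  have hφt : Tendsto φ atTop atTop := hφ.tendsto_atTop
  have hpos : ∀ᶠ k in atTop, (0 : ℝ) < φ k :=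
    (hφt.eventually_gt_atTop 0).mono fun k hk => by exact_mod_cast hk
  have hh : h ∈ almostEntropicFunctions (NetVar S (PartitionLabel T) E) :=
    isClosed_closure.mem_of_tendsto hlim (Eventually.of_forall fun k => hg _)
  have hpoly := almostEntropicFunctions_subset_polymatroids hh
  refine ⟨h, hh, fun W Z => ?_, fun e => ?_, fun u => ?_, fun e => ?_⟩
  · rw [sub_eq_zero]
    refine tendsto_nhds_unique (hlim' _) (tendsto_const_nhds.congr' ?_)
    filter_upwards [hpos] with k hk
    simp only [g]
    rw [blockEntropy_source]
    field_simp
  · rw [sub_eq_zero]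
    refine tendsto_nhds_unique (hlim' _) ((hlim' _).congr fun k => ?_)
    simp only [g]
    rw [blockEntropy_encode]
  · rw [sub_eq_zero]
    refine polymatroids_image_union_eq hpoly _ _ (Set.toFinite _) fun s hu => ?_
    refine le_antisymm ?_ (hpoly.2.1 _ _ Set.subset_union_right)
    have hinv : Tendsto (fun k => ((φ k : ℕ) : ℝ)⁻¹) atTop (𝓝 0) :=
      tendsto_inv_atTop_nhds_zero_nat.comp hφt
    have h1 := ((hlim' (NetVar.X '' N.sourcesAt u ∪ NetVar.U '' N.edgesInto u)).add hinv).add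
      (((herr s u hu).comp hφt).mul_const (Real.log (Fintype.card (A s)) / Real.log 2))
    rw [add_zero, zero_mul, add_zero] at h1
    refine le_of_tendsto_of_tendsto (hlim' _) h1 ?_
    filter_upwards [hpos] with k hk
    have h2 := blockEntropy_decode T (c (φ k)) P s u hu
    simp only [g, Function.comp]
    rw [inv_mul_le_iff₀ hk, div_le_iff₀ hlog]
    refine h2.trans (le_of_eq ?_)
    field_simp
  · rw [sub_nonneg]
    refine le_of_forall_pos_le_add fun ε hε => le_of_tendsto (hlim' _) ?_
    filter_upwards [hpos, hφt.eventually (hrate e ε hε)] with k hk hk'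
    simp only [g]
    rw [inv_mul_le_iff₀ hk]
    refine le_trans ?_ hk'
    exact div_le_div_of_nonneg_right (blockEntropy_edge_le T (c (φ k)) P e) hlog.le

/-! ### The polymatroid region is a polyhedron -/

/-- The defining system of the region is linear with integer coefficients in `h`, the capacities
and the source entropies, and the support alone determines it; eliminating `h` leaves finitely many
inequalities. -/
theorem exists_outerRegion_polymatroids_eq {V E S : Type*} [Finite V] [Fintype E]
    [Fintype S] [DecidableEq S] {A : S → Type*} [∀ s, Fintype (A s)] [∀ s, DecidableEq (A s)]
    (N : Network V E S) (T : Finset (∀ s, A s)) :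
    ∃ (m : ℕ) (M : Fin m → E → ℤ) (K : Fin m → Finset S → Finset (PartitionLabel T) → ℤ),
      ∀ P : PMF (∀ s, A s),
        outerRegion N T P (polymatroids (NetVar S (PartitionLabel T) E)) =
          {C : E → ℝ | ∀ i, ∑ W, ∑ Z, (K i W Z : ℝ) * sourceEntropy P W Z ≤
            ∑ e, (M i e : ℝ) * C e} := by
  classical
  let G := NetVar S (PartitionLabel T) E
  let κ := E ⊕ (Finset S × Finset (PartitionLabel T))
  let _ : Fintype (Set G) := Fintype.ofFinite _
  have hα : ∀ α : Set G, IsIntLinear fun x : Set G ⊕ κ → ℝ => x (.inl α) := fun α => .apply _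
  have hH : ∀ W Z, IsIntLinear fun x : Set G ⊕ κ → ℝ => x (.inr (.inr (W, Z))) :=
    fun W Z => .apply _
  have hC : ∀ e, IsIntLinear fun x : Set G ⊕ κ → ℝ => x (.inr (.inl e)) := fun e => .apply _
  have hzero : IsIntLinear fun _ : Set G ⊕ κ → ℝ => 0 := .zero
  have hsys : IsIntCone {x : Set G ⊕ κ → ℝ |
      (x (.inl ∅) = 0 ∧ (∀ α β : Set G, α ⊆ β → x (.inl α) ≤ x (.inl β)) ∧
        ∀ α β : Set G, x (.inl (α ∪ β)) + x (.inl (α ∩ β)) ≤ x (.inl α) + x (.inl β)) ∧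
      (∀ (W : Finset S) (Z : Finset (PartitionLabel T)),
        x (.inl (.X '' (W : Set S) ∪ .B '' (Z : Set (PartitionLabel T)))) -
          x (.inr (.inr (W, Z))) = 0) ∧
      (∀ e, x (.inl ({.U e} ∪ (.X '' N.sourcesAt (N.tail e) ∪ .U '' N.edgesInto (N.tail e)))) -
        x (.inl (.X '' N.sourcesAt (N.tail e) ∪ .U '' N.edgesInto (N.tail e))) = 0) ∧
      (∀ u, x (.inl (.X '' {s | u ∈ N.dst s} ∪ (.X '' N.sourcesAt u ∪ .U '' N.edgesInto u))) -
        x (.inl (.X '' N.sourcesAt u ∪ .U '' N.edgesInto u)) = 0) ∧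
      ∀ e, 0 ≤ x (.inr (.inl e)) - x (.inl {.U e})} := by
    refine .and (.and ?_ (.and ?_ ?_)) (.and ?_ (.and ?_ (.and ?_ ?_)))
    · exact (hα _).isIntCone_eq hzero
    · exact .forall fun α => .forall fun β => .imp _ ((hα _).isIntCone_le (hα _))
    · exact .forall fun α => .forall fun β =>
        ((hα _).add (hα _)).isIntCone_le ((hα _).add (hα _))
    · exact .forall fun W => .forall fun Z => ((hα _).sub (hH W Z)).isIntCone_eq hzero
    · exact .forall fun e => ((hα _).sub (hα _)).isIntCone_eq hzero
    · exact .forall fun u => ((hα _).sub (hα _)).isIntCone_eq hzero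
    · exact .forall fun e => hzero.isIntCone_le ((hC e).sub (hα _))
  obtain ⟨F, hF⟩ := hsys.exists_finite
  refine ⟨F.card, fun i e => (F.equivFin.symm i : κ → ℤ) (.inl e),
    fun i W Z => -(F.equivFin.symm i : κ → ℤ) (.inr (W, Z)), fun P => ?_⟩
  ext C
  have := Set.ext_iff.1 hF (Sum.elim C fun WZ => sourceEntropy P WZ.1 WZ.2)
  refine Iff.trans (Iff.trans ?_ this) ?_
  · exact ⟨fun ⟨h, h1, h2⟩ => ⟨h, h1, h2⟩, fun ⟨h, h1, h2⟩ => ⟨h, h1, h2⟩⟩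
  · have hrow : ∀ a : κ → ℤ,
        0 ≤ ∑ k, (a k : ℝ) * (Sum.elim C fun WZ => sourceEntropy P WZ.1 WZ.2 : κ → ℝ) k ↔
          ∑ W, ∑ Z, ((-a (.inr (W, Z)) : ℤ) : ℝ) * sourceEntropy P W Z ≤
            ∑ e, (a (.inl e) : ℝ) * C e := fun a => by
      rw [Fintype.sum_sum_type, Fintype.sum_prod_type]
      simp only [Sum.elim_inl, Sum.elim_inr, Int.cast_neg, neg_mul, Finset.sum_neg_distrib]
      exact ⟨fun h => by linarith, fun h => by linarith⟩
    simp only [Set.mem_ofPred_eq, ← hrow]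
    exact ⟨fun h i => h _ (F.equivFin.symm i).2, fun h a ha => by
      simpa using h (F.equivFin ⟨a, ha⟩)⟩

theorem corollary1 {V E S : Type*} [Fintype V] [Fintype E] [Fintype S] [DecidableEq S]
    {A : S → Type*} [∀ s, Fintype (A s)] [∀ s, DecidableEq (A s)]
    (N : Network V E S) (T : Finset (∀ s, A s)) :
    (∀ P : PMF (∀ s, A s), P.support = (T : Set (∀ s, A s)) →
      N.achievable P ⊆
        outerRegion N T P (almostEntropicFunctions (NetVar S (PartitionLabel T) E)) ∧
      N.achievable P ⊆ outerRegion N T P (polymatroids (NetVar S (PartitionLabel T) E))) ∧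
    ∃ (m : ℕ) (M : Fin m → E → ℤ)
      (K : Fin m → Finset S → Finset (PartitionLabel T) → ℤ),
      ∀ P : PMF (∀ s, A s), P.support = (T : Set (∀ s, A s)) →
        outerRegion N T P (polymatroids (NetVar S (PartitionLabel T) E)) =
          {C : E → ℝ | ∀ i, ∑ W, ∑ Z, (K i W Z : ℝ) * sourceEntropy P W Z ≤
            ∑ e, (M i e : ℝ) * C e} := by
  refine ⟨fun P _ => ?_, ?_⟩
  · have h := achievable_subset_outerRegion N T P
    exact ⟨h, h.trans (outerRegion_mono N T P almostEntropicFunctions_subset_polymatroids)⟩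
  · obtain ⟨m, M, K, h⟩ := exists_outerRegion_polymatroids_eq N T
    exact ⟨m, M, K, fun P _ => h P⟩
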